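/- Let $\mathbb T^2=\mathbb R^2/\mathbb Z^2$ and let $(\alpha,\beta)\in\mathbb R^2$ be totally irrational, i.e. $1,\alpha,\beta$ are linearly independent over $\mathbb Q$. Let $\widetilde R_{(\alpha,\beta)}:\mathbb R^2\to\mathbb R^2$, $x\mapsto x+(\alpha,\beta)$, be the lift of the rigid rotation $R_{(\alpha,\beta)}$ of $\mathbb T^2$. For a lift $\widetilde g:\mathbb R^2\to\mathbb R^2$ of a homeomorphism $g$ of $\mathbb T^2$ homotopic to the identity, let $\rho(\widetilde g)$ be its Misiurewicz–Ziemian rotation set, i.e. the set of all limits $v=\lim_{k\to\infty}\frac1{n_k}\bigl(\widetilde g^{\,n_k}(z_k)-z_k\bigr)$ with $n_k\in\mathbb N$, $n_k\to\infty$ and $z_k\in\mathbb R^2$. Then for every $\varepsilon>0$ there is a lift $\widetilde g$ of an orientation-preserving homeomorphism of $\mathbb T^2$ homotopic to the identity such that $$\sup_{x\in\mathbb R^2}\bigl\|\widetilde g(x)-\widetilde R_{(\alpha,\beta)}(x)\bigr\|<\varepsilon,$$ $\rho(\widetilde g)$ has non-empty interior, and $(\alpha,\beta)\in\operatorname{Int}\rho(\widetilde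 g)$. -/

import Mathlib

open Filter Topology

noncomputable section

namespace TorusRotation

/-- The plane with its Euclidean metric, the universal cover of the two-torus. -/
abbrev Plane : Type := EuclideanSpace ℝ (Fin 2)

/-- The two-torus `ℝ² / ℤ²`. -/
abbrev Torus : Type := UnitAddTorus (Fin 2)

/-- The natural projection `ℝ² → ℝ² / ℤ²`. -/
def proj (x : Plane) : Torus := fun i => (x i : UnitAddCircle)

/-- An integer vector, as a point of the plane. -/
def latticePoint (m : Fin 2 → ℤ) : Plane := WithLp.toLp 2 (fun i => (m i : ℝ))

/-- `F : ℝ² → ℝ²` is a lift of `f : 𝕋² → 𝕋²`. -/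
def IsLift (F : Plane → Plane) (f : Torus → Torus) : Prop :=
  Continuous F ∧ ∀ x, proj (F x) = f (proj x)

/-- A homeomorphism of the torus preserves orientation if it has positive degree. Any lift `F` of
`f` satisfies `F (x + m) = F x + A m` for an integer matrix `A`, the action of `f` on
`H₁(𝕋²; ℤ) = ℤ²`, and the degree of `f` is `det A`. -/
def IsOrientationPreserving (f : Torus ≃ₜ Torus) : Prop :=
  ∃ (F : Plane → Plane) (A : Matrix (Fin 2) (Fin 2) ℤ), IsLift F f ∧ 0 < A.det ∧
    ∀ (x : Plane) (m : Fin 2 → ℤ),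
      F (x + latticePoint m) = F x + latticePoint (A.mulVec m)

/-- The set of orientation-preserving homeomorphisms of the torus that are homotopic to the
identity. -/
def homeoZero : Set (Torus ≃ₜ Torus) :=
  {f | IsOrientationPreserving f ∧
    ContinuousMap.Homotopic (f : C(Torus, Torus)) (ContinuousMap.id Torus)}

/-- The set of lifts to the plane of the elements of `homeoZero`. -/
def liftedHomeoZero : Set (Plane ≃ₜ Plane) :=
  {F | ∃ f ∈ homeoZero, IsLift F f}

/-- The uniform distance between two maps of the plane (`∞` if they are not at bounded
distance). -/
def distCZero (F G : Plane → Plane) : ENNReal := ⨆ x, edist (F x) (G x)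

/-- The Misiurewicz–Ziemian rotation set: all limits of `(F^{n_k}(z_k) - z_k) / n_k` with
`n_k → ∞` and `z_k` in the plane. -/
def rotationSet (F : Plane → Plane) : Set Plane :=
  {v | ∃ (n : ℕ → ℕ) (z : ℕ → Plane), Tendsto n atTop atTop ∧
    Tendsto (fun k => (n k : ℝ)⁻¹ • (F^[n k] (z k) - z k)) atTop (𝓝 v)}

/-- `(α, β)` is totally irrational: `1, α, β` are linearly independent over `ℚ`. -/
def TotallyIrrational (α β : ℝ) : Prop := LinearIndependent ℚ ![(1 : ℝ), α, β]

/-- The rigid translation `x ↦ x + v` of the plane, which is a lift of the rigid rotation of the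
torus by `v`. -/
def rigidTranslation (v : Plane) : Plane ≃ₜ Plane := Homeomorph.addRight v

end TorusRotation

end

/-!
The rotation `R` by `(α, β)` is perturbed by high-frequency shears. Suppose that `h` is a
homeomorphism of the plane commuting with integer translations and at bounded distance from the
translation by `N (α, β)`. Then `x ↦ h (N x) / N` is a lift of a torus homeomorphism, it is
`O(1 / N)`-close to `R`, and its rotation set is `ρ(h) / N`. Hence it suffices to have a map `f` at
bounded distance from the identity whose rotation set contains `[-1, 1]²`: with `m` the integer
vector nearest to `N (α, β)`, the map `h = f + m` has `N (α, β)` in the interior of its rotation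
set.

Such an `f` is the composition of the shears `(x, y) ↦ (x + φ y, y)` and
`(x, y) ↦ (x, y + φ x)`, where `φ t = 10 (‖t‖ - 1/4)` is a steep triangular wave (`‖t‖` is the
distance from `t` to the nearest integer). Writing an orbit as a single sequence `x₀, y₀, x₁, y₁, …`,
the dynamics become the recurrence `s (j + 2) = s j + φ (s (j + 1))`
(`orbit_eq_of_recurrence`). On each interval `[n, n + 1/2]` with `n` an integer the wave is affine
of slope `10`, so for prescribed integers `S j` with `|S (j + 2) - S j| ≤ 2`, an orbit with
`s j ∈ [S j, S j + 1/2]` is a bounded solution of a linear system. That system is the fixed point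
equation of a contraction of the space of bounded sequences (`exists_shadowing_sequence`,
`exists_wave_recurrence`). With `S` interleaving `⌊k a⌋` and `⌊k b⌋`, the orbit has rotation vector
`(a, b)`, and undoing the rescaling gives `mem_rotationSet_doubleShear`.
-/

open Filter Topology

noncomputable section

namespace TorusRotation

/-! ### Shears of the plane and of the torus -/

lemma continuous_euclideanSpace_single (i : Fin 2) :
    Continuous fun x : ℝ => (EuclideanSpace.single i x : Plane) :=
  (PiLp.continuous_toLp 2 _).comp (continuous_single (A := fun _ : Fin 2 => ℝ) i)

/-- The shear of the plane adding to the `i`-th coordinate a periodic function of the `j`-th one,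
given as a function on the circle. -/
def planeShear (i j : Fin 2) (hij : i ≠ j) (c : C(UnitAddCircle, ℝ)) : Plane ≃ₜ Plane where
  toFun p := p + EuclideanSpace.single i (c (p j : UnitAddCircle))
  invFun p := p - EuclideanSpace.single i (c (p j : UnitAddCircle))
  left_inv p := by simp [hij.symm]
  right_inv p := by simp [hij.symm]
  continuous_toFun := by
    have h : Continuous fun p : Plane => c (p j : UnitAddCircle) :=
      c.continuous.comp ((AddCircle.continuous_mk' 1).comp (by fun_prop))
    exact continuous_id.add ((continuous_euclideanSpace_single i).comp h)
  continuous_invFun := by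
    have h : Continuous fun p : Plane => c (p j : UnitAddCircle) :=
      c.continuous.comp ((AddCircle.continuous_mk' 1).comp (by fun_prop))
    exact continuous_id.sub ((continuous_euclideanSpace_single i).comp h)

/-- The shear of the torus covered by `planeShear i j hij c`. -/
def torusShear (i j : Fin 2) (hij : i ≠ j) (c : C(UnitAddCircle, ℝ)) : Torus ≃ₜ Torus where
  toFun p := p + Pi.single i (c (p j) : UnitAddCircle)
  invFun p := p - Pi.single i (c (p j) : UnitAddCircle)
  left_inv p := by simp [hij.symm]
  right_inv p := by simp [hij.symm]
  continuous_toFun := by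
    have h : Continuous fun p : Torus => (c (p j) : UnitAddCircle) :=
      (AddCircle.continuous_mk' 1).comp (by fun_prop)
    exact continuous_id.add ((continuous_single i).comp h)
  continuous_invFun := by
    have h : Continuous fun p : Torus => (c (p j) : UnitAddCircle) :=
      (AddCircle.continuous_mk' 1).comp (by fun_prop)
    exact continuous_id.sub ((continuous_single i).comp h)

lemma proj_planeShear (i j : Fin 2) (hij : i ≠ j) (c : C(UnitAddCircle, ℝ)) (p : Plane) :
    proj (planeShear i j hij c p) = torusShear i j hij c (proj p) := by
  ext k
  by_cases h : k = i
  · subst h; simp [proj, planeShear, torusShear]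
  · simp [proj, planeShear, torusShear, h]

lemma planeShear_add_latticePoint (i j : Fin 2) (hij : i ≠ j) (c : C(UnitAddCircle, ℝ))
    (p : Plane) (m : Fin 2 → ℤ) :
    planeShear i j hij c (p + latticePoint m) = planeShear i j hij c p + latticePoint m := by
  simp [planeShear, latticePoint, add_right_comm]

lemma torusShear_homotopic_id (i j : Fin 2) (hij : i ≠ j) (c : C(UnitAddCircle, ℝ)) :
    ContinuousMap.Homotopic (torusShear i j hij c : C(Torus, Torus))
      (ContinuousMap.id Torus) := by
  refine ContinuousMap.Homotopic.symm ⟨{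
    toFun := fun q => q.2 + Pi.single i ((q.1 : ℝ) * c (q.2 j) : ℝ)
    continuous_toFun := ?_
    map_zero_left := fun p => by simp
    map_one_left := fun p => by simp [torusShear] }⟩
  have h : Continuous fun q : unitInterval × Torus =>
      (((q.1 : ℝ) * c (q.2 j) : ℝ) : UnitAddCircle) :=
    (AddCircle.continuous_mk' 1).comp (by fun_prop)
  exact continuous_snd.add ((continuous_single i).comp h)

/-- The plane homeomorphism `(x, y) ↦ (x', y + c₁ x')` with `x' = x + c₀ y`. -/
def doubleShear (c₀ c₁ : C(UnitAddCircle, ℝ)) : Plane ≃ₜ Plane :=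
  (planeShear 0 1 (by decide) c₀).trans (planeShear 1 0 (by decide) c₁)

lemma doubleShear_zero (c₀ c₁ : C(UnitAddCircle, ℝ)) (p : Plane) :
    doubleShear c₀ c₁ p 0 = p 0 + c₀ (p 1 : UnitAddCircle) := by
  simp [doubleShear, planeShear]

lemma doubleShear_one (c₀ c₁ : C(UnitAddCircle, ℝ)) (p : Plane) :
    doubleShear c₀ c₁ p 1 =
      p 1 + c₁ ((p 0 + c₀ (p 1 : UnitAddCircle) : ℝ) : UnitAddCircle) := by
  simp [doubleShear, planeShear]

lemma doubleShear_mem_liftedHomeoZero (c₀ c₁ : C(UnitAddCircle, ℝ)) :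
    doubleShear c₀ c₁ ∈ liftedHomeoZero := by
  have hlift : IsLift (doubleShear c₀ c₁)
      ((torusShear 0 1 (by decide) c₀).trans (torusShear 1 0 (by decide) c₁)) :=
    ⟨(doubleShear c₀ c₁).continuous, fun x => by simp [doubleShear, proj_planeShear]⟩
  refine ⟨_, ⟨⟨doubleShear c₀ c₁, 1, hlift, by simp, fun x m => ?_⟩, ?_⟩, hlift⟩
  · simp [doubleShear, planeShear_add_latticePoint]
  · exact (torusShear_homotopic_id 1 0 (by decide) c₁).comp
      (torusShear_homotopic_id 0 1 (by decide) c₀)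

/-- If both shears displace by nearly the coordinates of `v`, then the double shear is uniformly
close to the translation by `v`. -/
lemma distCZero_doubleShear_le (c₀ c₁ : C(UnitAddCircle, ℝ)) (v : Plane) {δ : ℝ}
    (h₀ : ∀ t, |c₀ t - v 0| ≤ δ) (h₁ : ∀ t, |c₁ t - v 1| ≤ δ) :
    distCZero (doubleShear c₀ c₁) (rigidTranslation v) ≤ ENNReal.ofReal (2 * δ) := by
  refine iSup_le fun x => ?_
  rw [edist_dist]
  refine ENNReal.ofReal_le_ofReal ?_
  have hδ : 0 ≤ δ := (abs_nonneg _).trans (h₀ 0)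
  have e₀ := h₀ (x 1 : UnitAddCircle)
  have e₁ := h₁ ((x 0 + c₀ (x 1 : UnitAddCircle) : ℝ) : UnitAddCircle)
  rw [EuclideanSpace.dist_eq]
  refine Real.sqrt_le_iff.2 ⟨by positivity, ?_⟩
  rw [Fin.sum_univ_two, doubleShear_zero, doubleShear_one, Real.dist_eq, Real.dist_eq]
  have k₀ := pow_le_pow_left₀ (abs_nonneg _) e₀ 2
  have k₁ := pow_le_pow_left₀ (abs_nonneg _) e₁ 2
  simp only [rigidTranslation, Homeomorph.coe_addRight, PiLp.add_apply, add_sub_add_left_eq_sub]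
  nlinarith

/-! ### Orbits shadowing integer sequences -/

/-- The linear recurrence satisfied by the deviation of an orbit from an integer sequence has a
solution bounded by `1/4`: its right-hand side is a contraction of the space of bounded sequences. -/
lemma exists_shadowing_sequence (D : ℕ → ℝ) (hD : ∀ j, |D j| ≤ 2) :
    ∃ t : ℕ → ℝ, (∀ j, |t j| ≤ 1 / 4) ∧
      ∀ j, 10 * t (j + 1) = t (j + 2) - t j + D j := by
  -- the value at `0` is not constrained by the equation and is set to `0`
  let T : (ℕ → ℝ) → ℕ → ℝ := fun t j =>
    Nat.casesOn j 0 fun j => (t (j + 2) - t j + D j) / 10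
  have hT : ∀ (t : BoundedContinuousFunction ℕ ℝ) (j : ℕ), ‖T t j‖ ≤ (2 * ‖t‖ + 2) / 10 := by
    intro t j
    rcases j with _ | j
    · rw [show T t 0 = 0 from rfl, norm_zero]
      positivity
    · have h₁ := abs_le.1 (t.norm_coe_le_norm (j + 2))
      have h₂ := abs_le.1 (t.norm_coe_le_norm j)
      have h₃ := abs_le.1 (hD j)
      simp only [T, Real.norm_eq_abs]
      rw [abs_le]; constructor <;> linarith
  let Φ : BoundedContinuousFunction ℕ ℝ → BoundedContinuousFunction ℕ ℝ := fun t =>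
    BoundedContinuousFunction.ofNormedAddCommGroupDiscrete (T t) _ (hT t)
  have hΦ : ContractingWith (1 / 5) Φ := by
    refine ⟨by rw [← NNReal.coe_lt_coe]; norm_num, LipschitzWith.of_dist_le_mul fun s t => ?_⟩
    refine (BoundedContinuousFunction.dist_le (by positivity)).2 fun j => ?_
    have hd : 0 ≤ dist s t := dist_nonneg
    rcases j with _ | j
    · simp [Φ, T, hd]
    · have h₁ := abs_le.1 ((Real.dist_eq _ _).symm.trans_le (s.dist_coe_le_dist (g := t) (j + 2)))
      have h₂ := abs_le.1 ((Real.dist_eq _ _).symm.trans_le (s.dist_coe_le_dist (g := t) j))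
      simp only [Φ, T, BoundedContinuousFunction.coe_ofNormedAddCommGroupDiscrete, Real.dist_eq]
      push_cast
      rw [abs_le]; constructor <;> linarith
  let t := hΦ.fixedPoint
  have ht : Φ t = t := hΦ.fixedPoint_isFixedPt
  have hval : ∀ j, t j = T t j := fun j => (DFunLike.congr_fun ht j).symm
  have hnorm : ‖t‖ ≤ 1 / 4 := by
    have : ‖t‖ ≤ (2 * ‖t‖ + 2) / 10 :=
      (BoundedContinuousFunction.norm_le (by positivity)).2 fun j => hval j ▸ hT t j
    linarith
  refine ⟨t, fun j => (t.norm_coe_le_norm j).trans hnorm, fun j => ?_⟩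
  rw [hval (j + 1)]
  simp only [T]
  ring

/-- The triangular wave has slope one on the first half of each period. -/
lemma norm_coe_int_add_quarter_add (n : ℤ) {u : ℝ} (hu : |u| ≤ 1 / 4) :
    ‖((n + 1 / 4 + u : ℝ) : UnitAddCircle)‖ = 1 / 4 + u := by
  obtain ⟨h₁, h₂⟩ := abs_le.1 hu
  have hn : ((n : ℝ) : UnitAddCircle) = 0 := (AddCircle.coe_eq_zero_iff 1).2 ⟨n, by simp⟩
  rw [add_assoc, AddCircle.coe_add, hn, zero_add,
    (AddCircle.norm_coe_eq_abs_iff 1 one_ne_zero).2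
      (by rw [abs_le]; constructor <;> norm_num <;> linarith)]
  exact abs_of_nonneg (by linarith)

/-- Every integer sequence `S` with `|S (j + 2) - S j| ≤ 2` is shadowed by an orbit of the
recurrence that encodes the composition of the two shears by the wave `10 (‖·‖ - 1/4)`. -/
lemma exists_wave_recurrence (S : ℕ → ℤ) (hS : ∀ j, |S (j + 2) - S j| ≤ 2) :
    ∃ s : ℕ → ℝ, (∀ j, |s j - S j| ≤ 1 / 2) ∧
      ∀ j, s (j + 2) = s j + 10 * (‖(s (j + 1) : UnitAddCircle)‖ - 1 / 4) := by
  obtain ⟨t, ht, hrec⟩ := exists_shadowing_sequence (fun j => ((S (j + 2) - S j : ℤ) : ℝ))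
    fun j => by exact_mod_cast hS j
  refine ⟨fun j => S j + 1 / 4 + t j, fun j => ?_, fun j => ?_⟩
  · have := abs_le.1 (ht j)
    rw [abs_le]; constructor <;> linarith
  · have := hrec j
    push_cast at this
    rw [norm_coe_int_add_quarter_add _ (ht (j + 1))]
    linarith

/-- A sequence with prescribed linear growth rates `a` along even and `b` along odd indices,
satisfying the wave recurrence. -/
lemma exists_wave_recurrence_of_slopes {a b : ℝ} (ha : |a| ≤ 1) (hb : |b| ≤ 1) :
    ∃ s : ℕ → ℝ, (∀ k : ℕ, |s (2 * k) - k * a| ≤ 2) ∧ (∀ k : ℕ, |s (2 * k + 1) - k * b| ≤ 2) ∧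
      ∀ j, s (j + 2) = s j + 10 * (‖(s (j + 1) : UnitAddCircle)‖ - 1 / 4) := by
  let S : ℕ → ℤ := fun j => ⌊((j / 2 : ℕ) : ℝ) * if Even j then a else b⌋
  have hstep : ∀ (k : ℕ) {c : ℝ}, |c| ≤ 1 → |⌊((k + 1 : ℕ) : ℝ) * c⌋ - ⌊(k : ℝ) * c⌋| ≤ 2 := by
    intro k c hc
    obtain ⟨h₁, h₂⟩ := abs_le.1 hc
    have e₁ := Int.floor_le (((k + 1 : ℕ) : ℝ) * c)
    have e₂ := Int.lt_floor_add_one (((k + 1 : ℕ) : ℝ) * c)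
    have e₃ := Int.floor_le ((k : ℝ) * c)
    have e₄ := Int.lt_floor_add_one ((k : ℝ) * c)
    push_cast at e₁ e₂ ⊢
    rw [abs_le]
    constructor
    · have : (-2 : ℝ) < ⌊((k : ℝ) + 1) * c⌋ - ⌊(k : ℝ) * c⌋ := by linarith
      exact_mod_cast this.le
    · have : (⌊((k : ℝ) + 1) * c⌋ - ⌊(k : ℝ) * c⌋ : ℝ) < 2 := by linarith
      exact_mod_cast this.le
  obtain ⟨s, hs, hrec⟩ := exists_wave_recurrence S fun j => by
    have hj : (j + 2) / 2 = j / 2 + 1 := by omega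
    simp only [S, hj, Nat.even_add, even_two, iff_true]
    split_ifs
    · exact hstep _ ha
    · exact hstep _ hb
  refine ⟨s, fun k => ?_, fun k => ?_, hrec⟩
  · have h := abs_le.1 (hs (2 * k))
    have hS : S (2 * k) = ⌊(k : ℝ) * a⌋ := by simp [S]
    rw [hS] at h
    have e₁ := Int.floor_le ((k : ℝ) * a)
    have e₂ := Int.lt_floor_add_one ((k : ℝ) * a)
    rw [abs_le]; constructor <;> linarith
  · have h := abs_le.1 (hs (2 * k + 1))
    have hd : (2 * k + 1) / 2 = k := by omega
    have hS : S (2 * k + 1) = ⌊(k : ℝ) * b⌋ := by simp [S, hd]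
    rw [hS] at h
    have e₁ := Int.floor_le ((k : ℝ) * b)
    have e₂ := Int.lt_floor_add_one ((k : ℝ) * b)
    rw [abs_le]; constructor <;> linarith

/-! ### The rotation set of the rescaled wave map -/

/-- The wave `10 (‖·‖ - 1/4)`, shifted by `m` and then rescaled to period and amplitude `1 / N`
times the original ones. It is still a function on the circle because `N` is an integer. -/
def scaledWave (N : ℕ) (m : ℤ) : C(UnitAddCircle, ℝ) where
  toFun t := (10 * (‖N • t‖ - 1 / 4) + m) / N
  continuous_toFun := by fun_prop

lemma abs_scaledWave_sub_le {N : ℕ} (hN : 0 < N) (x : ℝ) (t : UnitAddCircle) :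
    |scaledWave N (round (N * x)) t - x| ≤ 3 / N := by
  have hN' : (0 : ℝ) < N := by exact_mod_cast hN
  have h₁ := norm_nonneg (N • t)
  have h₂ : ‖N • t‖ ≤ 1 / 2 := by
    simpa using AddCircle.norm_le_half_period 1 one_ne_zero (x := N • t)
  have h₃ := abs_le.1 (abs_sub_round ((N : ℝ) * x))
  have h : scaledWave N (round (N * x)) t - x =
      (10 * (‖N • t‖ - 1 / 4) + round (N * x) - N * x) / N := by
    simp only [scaledWave, ContinuousMap.coe_mk]; field_simp
  rw [h, abs_div, abs_of_pos hN']
  gcongr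
  rw [abs_le]; constructor <;> linarith

/-- The integer shift `l` accumulated by an orbit is invisible to the rescaled wave. -/
lemma scaledWave_coe_div {N : ℕ} (hN : 0 < N) (m l : ℤ) (x : ℝ) :
    scaledWave N m (((x + l) / N : ℝ) : UnitAddCircle) =
      (10 * (‖(x : UnitAddCircle)‖ - 1 / 4) + m) / N := by
  have hN' : (N : ℝ) ≠ 0 := by exact_mod_cast hN.ne'
  have hl : ((l : ℝ) : UnitAddCircle) = 0 := (AddCircle.coe_eq_zero_iff 1).2 ⟨l, by simp⟩
  have h : N • (((x + l) / N : ℝ) : UnitAddCircle) = x := by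
    rw [← AddCircle.coe_nsmul, nsmul_eq_mul, mul_div_cancel₀ _ hN', AddCircle.coe_add, hl, add_zero]
  simp only [scaledWave, ContinuousMap.coe_mk, h]

/-- Consecutive pairs of terms of a wave recurrence, rescaled and shifted, form an orbit of the
double shear. -/
lemma orbit_eq_of_recurrence {N : ℕ} (hN : 0 < N) (m₀ m₁ : ℤ) {s : ℕ → ℝ}
    (hs : ∀ j, s (j + 2) = s j + 10 * (‖(s (j + 1) : UnitAddCircle)‖ - 1 / 4)) (k : ℕ) :
    (doubleShear (scaledWave N m₀) (scaledWave N m₁))^[k] !₂[s 0 / N, s 1 / N] =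
      !₂[(s (2 * k) + k * m₀) / N, (s (2 * k + 1) + k * m₁) / N] := by
  induction k with
  | zero => simp
  | succ k ih =>
    have hw₀ : scaledWave N m₀ (((s (2 * k + 1) + k * m₁) / N : ℝ) : UnitAddCircle) =
        (10 * (‖(s (2 * k + 1) : UnitAddCircle)‖ - 1 / 4) + m₀) / N := by
      simpa using scaledWave_coe_div hN m₀ (k * m₁) (s (2 * k + 1))
    have hx : (s (2 * k) + k * m₀) / N +
        (10 * (‖(s (2 * k + 1) : UnitAddCircle)‖ - 1 / 4) + m₀) / N =
        (s (2 * k + 2) + ((k + 1 : ℕ) * m₀ : ℤ)) / N := by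
      rw [hs (2 * k)]; push_cast; ring
    rw [Function.iterate_succ_apply', ih]
    ext i
    fin_cases i
    · simp only [Fin.zero_eta, doubleShear_zero]
      simp only [Matrix.cons_val_zero, Matrix.cons_val_one, hw₀, hx]
      push_cast
      rw [mul_add]
    · simp only [Fin.mk_one, doubleShear_one]
      simp only [Matrix.cons_val_zero, Matrix.cons_val_one, hw₀, hx]
      rw [scaledWave_coe_div hN, show 2 * (k + 1) + 1 = 2 * k + 1 + 2 by ring, hs (2 * k + 1)]
      push_cast
      ring

/-- A sequence staying at bounded distance from `k c` has slope `c`. -/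
lemma tendsto_inv_mul_of_abs_sub_le {x : ℕ → ℝ} {c C : ℝ} (h : ∀ k : ℕ, |x k - k * c| ≤ C) :
    Tendsto (fun k : ℕ => (k : ℝ)⁻¹ * x k) atTop (𝓝 c) := by
  have h₀ : Tendsto (fun k : ℕ => (k : ℝ)⁻¹ * x k - c) atTop (𝓝 0) := by
    refine squeeze_zero_norm' ?_ (tendsto_const_div_atTop_nhds_zero_nat C)
    filter_upwards [eventually_gt_atTop 0] with k hk
    have hk' : (0 : ℝ) < k := by exact_mod_cast hk
    have e : (k : ℝ)⁻¹ * x k - c = (x k - k * c) / k := by field_simp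
    rw [e, Real.norm_eq_abs, abs_div, abs_of_pos hk']
    gcongr
    exact h k
  simpa using h₀.add_const c

lemma mem_rotationSet_doubleShear {N : ℕ} (hN : 0 < N) (m₀ m₁ : ℤ) {w : Plane}
    (h₀ : |N * w 0 - m₀| ≤ 1) (h₁ : |N * w 1 - m₁| ≤ 1) :
    w ∈ rotationSet (doubleShear (scaledWave N m₀) (scaledWave N m₁)) := by
  have hN' : (0 : ℝ) < N := by exact_mod_cast hN
  obtain ⟨s, hs₀, hs₁, hrec⟩ := exists_wave_recurrence_of_slopes h₀ h₁
  -- both coordinates of the displacement along the orbit are `k w` up to a bounded error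
  have hbound : ∀ (x : ℕ → ℝ) (m : ℤ) (c : ℝ), (∀ k : ℕ, |x k - k * (N * c - m)| ≤ 2) →
      Tendsto (fun k : ℕ => (k : ℝ)⁻¹ * ((x k + k * m) / N - x 0 / N)) atTop (𝓝 c) := by
    intro x m c hx
    refine tendsto_inv_mul_of_abs_sub_le (C := 4 / N) fun k => ?_
    have e : (x k + k * m) / N - x 0 / N - k * c = (x k - k * (N * c - m) - x 0) / N := by
      field_simp; ring
    have a := abs_le.1 (hx k)
    have b := abs_le.1 (hx 0)
    simp only [Nat.cast_zero, zero_mul, sub_zero] at b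
    rw [e, abs_div, abs_of_pos hN']
    gcongr
    rw [abs_le]; constructor <;> linarith
  refine ⟨id, fun _ => !₂[s 0 / N, s 1 / N], tendsto_id, ?_⟩
  simp only [id, orbit_eq_of_recurrence hN m₀ m₁ hrec]
  have hlim : Tendsto (fun k : ℕ => ![(k : ℝ)⁻¹ * ((s (2 * k) + k * m₀) / N - s 0 / N),
      (k : ℝ)⁻¹ * ((s (2 * k + 1) + k * m₁) / N - s 1 / N)]) atTop (𝓝 (WithLp.ofLp w)) := by
    rw [tendsto_pi_nhds, Fin.forall_fin_two]
    exact ⟨hbound (fun k => s (2 * k)) m₀ (w 0) hs₀,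
      hbound (fun k => s (2 * k + 1)) m₁ (w 1) hs₁⟩
  refine (((PiLp.continuous_toLp 2 _).tendsto _).comp hlim).congr fun k => ?_
  ext i
  fin_cases i <;> simp

end TorusRotation

end

open TorusRotation in
theorem proposition4p1 (α β : ℝ) (hαβ : TorusRotation.TotallyIrrational α β)
    (ε : ℝ) (hε : 0 < ε) :
    ∃ g ∈ TorusRotation.liftedHomeoZero,
      TorusRotation.distCZero g (TorusRotation.rigidTranslation !₂[α, β]) < ENNReal.ofReal ε ∧
      (interior (TorusRotation.rotationSet g)).Nonempty ∧
      !₂[α, β] ∈ interior (TorusRotation.rotationSet g) := by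
  obtain ⟨N, hN⟩ := exists_nat_gt (6 / ε)
  have hN' : (0 : ℝ) < N := lt_trans (by positivity) hN
  have hN₀ : 0 < N := by exact_mod_cast hN'
  have hint : !₂[α, β] ∈ interior (rotationSet
      (doubleShear (scaledWave N (round (N * α))) (scaledWave N (round (N * β))))) := by
    let U : Set Plane := {w | |N * w 0 - round (N * α)| < 1 ∧ |N * w 1 - round (N * β)| < 1}
    have hU : IsOpen U := by
      refine IsOpen.and (isOpen_lt ?_ continuous_const) (isOpen_lt ?_ continuous_const) <;> fun_prop
    refine interior_maximal (fun w hw => mem_rotationSet_doubleShear hN₀ _ _ hw.1.le hw.2.le) hU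
      ⟨?_, ?_⟩
    · exact (abs_sub_round ((N : ℝ) * α)).trans_lt (by norm_num)
    · exact (abs_sub_round ((N : ℝ) * β)).trans_lt (by norm_num)
  refine ⟨_, doubleShear_mem_liftedHomeoZero _ _, ?_, ⟨_, hint⟩, hint⟩
  refine (distCZero_doubleShear_le _ _ _ (δ := 3 / N) (abs_scaledWave_sub_le hN₀ α)
    (abs_scaledWave_sub_le hN₀ β)).trans_lt ?_
  rw [ENNReal.ofReal_lt_ofReal_iff hε]
  rw [div_lt_iff₀ hε] at hN
  rw [← mul_div_assoc, div_lt_iff₀ hN']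
  linarith
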